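/- Consider languages of nonempty words. An encoder layer maps a sequence $\mathbf v_0,\dots,\mathbf v_{n-1}\in\mathbb R^d$ ($n\ge 1$) to a sequence $\mathbf v_0',\dots,\mathbf v_{n-1}'\in\mathbb R^e$. A \emph{standard} layer is given by affine maps $A,B\colon\mathbb R^d\to\mathbb R^d$ and $C\colon\mathbb R^{2d}\to\mathbb R^e$, and sets $\mathbf v_i'=C(\mathbf v_i,\mathbf v_{j_i})$, where $j_i$ is the least $j$ that maximizes $\langle A\mathbf v_i,B\mathbf v_j\rangle$. A \emph{ReLU} layer (with $e=d$) replaces one fixed coordinate $v_i^k$ of every vector by $\max\{0,v_i^k\}$. A \emph{unique hard attention transformer encoder (UHAT)} is a finite composition of such layers. A UHAT $T$ from $\mathbb R^d$ to $\mathbb R^e$ \emph{accepts} a language $L\subseteq\Sigma^+$ if there are $f\colon\Sigma\to\mathbb R^d$, $p\colon\mathbb N\times\mathbb N\to\mathbb R^d$ and $\mathbf t\in\mathbb R^e$ such that for every word $w=a_0\cdots a_{n-1}\in\Sigma^+$, if $\mathbf v_0,\dots,\mathbf v_{n-1}$ is the output of $T$ on $f(a_0)+p(0,n),\dots,f(a_{n-1})+p(n-1,n)$,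 then $\langle\mathbf t,\mathbf v_0\rangle>0$ when $w\in L$ and $\langle\mathbf t,\mathbf v_0\rangle<0$ when $w\notin L$. An $\mathsf{AC}^0$ family is a sequence $\{C_n\}_{n\in\mathbb N}$ of Boolean circuits, $C_n$ with $n$ inputs, with NOT gates and AND and OR gates of unbounded fan-in, of depth bounded by a constant and of size bounded by a polynomial in $n$; its language is the set of all $w\in\{0,1\}^+$ with $C_{|w|}(w)=1$. Say that $\{C_n\}$ \emph{approximates majority} if for every $n\ge1$ the circuit $C_n$ accepts all $x\in\{0,1\}^n$ with at least $2n/3$ ones and rejects all $x\in\{0,1\}^n$ with at most $n/3$ ones. Then: (1) There is an $\mathsf{AC}^0$ family that approximates majority. (2) For every $\mathsf{AC}^0$ family $\{C_n\}$ that approximates majority, no UHAT accepts the language of $\{C_n\}$. (3) Consequently, there is a language in $\mathsf{AC}^0$ that no UHAT accepts. -/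

import Mathlib

/-! ## Unique hard attention transformer encoders -/

/-- The least index that maximizes the attention score `s`. -/
noncomputable def leastArgmax {n : ℕ} [Nonempty (Fin n)] (s : Fin n → ℝ) : Fin n :=
  (Finset.univ.filter fun j => ∀ k, s k ≤ s j).min' (by
    obtain ⟨j, hj⟩ := Finite.exists_max s
    exact ⟨j, by simpa using hj⟩)

/-- An encoder layer turning sequences of vectors in `ℝ^d` into sequences of vectors in `ℝ^e`:
either a standard layer given by three affine maps, or a ReLU layer acting on one coordinate. -/
inductive EncoderLayer : ℕ → ℕ → Type
  | standard {d e : ℕ}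
      (A B : (Fin d → ℝ) →ᵃ[ℝ] (Fin d → ℝ))
      (C : ((Fin d → ℝ) × (Fin d → ℝ)) →ᵃ[ℝ] (Fin e → ℝ)) : EncoderLayer d e
  | relu {d : ℕ} (k : Fin d) : EncoderLayer d d

/-- The action of a layer on a sequence of length `n`. In a standard layer the score of position
`j` for position `i` is the inner product of `A (v i)` and `B (v j)`, and position `i` attends to
the least position of maximal score. -/
noncomputable def EncoderLayer.apply {n : ℕ} :
    {d e : ℕ} → EncoderLayer d e → (Fin n → Fin d → ℝ) → (Fin n → Fin e → ℝ)
  | _, _, .standard A B C, v => fun i =>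
      haveI : Nonempty (Fin n) := ⟨i⟩
      C (v i, v (leastArgmax fun j => A (v i) ⬝ᵥ B (v j)))
  | _, _, .relu k, v => fun i => Function.update (v i) k (max 0 (v i k))

/-- A unique hard attention transformer encoder: a finite composition of encoder layers. -/
inductive UHAT : ℕ → ℕ → Type
  | nil (d : ℕ) : UHAT d d
  | cons {d e f : ℕ} (layer : EncoderLayer d e) (rest : UHAT e f) : UHAT d f

/-- The sequence-to-sequence function computed by an encoder. -/
noncomputable def UHAT.apply {n : ℕ} :
    {d e : ℕ} → UHAT d e → (Fin n → Fin d → ℝ) → (Fin n → Fin e → ℝ)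
  | _, _, .nil _, v => v
  | _, _, .cons layer rest, v => rest.apply (layer.apply v)

/-- The real number that an encoder `T`, with symbol embedding `emb`, positional encoding `p` and
acceptance vector `t`, assigns to a nonempty word `w`: the inner product of `t` with the output
vector at position `0`. -/
noncomputable def UHAT.value {α : Type} {d e : ℕ} (T : UHAT d e) (emb : α → Fin d → ℝ)
    (p : ℕ → ℕ → Fin d → ℝ) (t : Fin e → ℝ) (w : List α) (hw : w ≠ []) : ℝ :=
  t ⬝ᵥ T.apply (fun i : Fin w.length => emb (w.get i) + p i w.length)
    ⟨0, List.length_pos_iff.mpr hw⟩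

/-- `T` accepts the language `L` of nonempty words. -/
def UHAT.Accepts {α : Type} {d e : ℕ} (T : UHAT d e) (L : Language α) : Prop :=
  ∃ (emb : α → Fin d → ℝ) (p : ℕ → ℕ → Fin d → ℝ) (t : Fin e → ℝ),
    ∀ (w : List α) (hw : w ≠ []),
      (w ∈ L → 0 < T.value emb p t w hw) ∧ (w ∉ L → T.value emb p t w hw < 0)

/-! ## Boolean circuits of unbounded fan-in and the class AC0 -/

/-- A gate over `n` input variables whose predecessors are among `k` earlier gates. The conjunction
and disjunction of the empty set of predecessors are the constants true and false. -/
inductive CircuitGate (n k : ℕ) : Type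
  | input (a : Fin n)
  | not (j : Fin k)
  | and (J : Finset (Fin k))
  | or (J : Finset (Fin k))

/-- A Boolean circuit with `n` inputs: a list of gates in topological order, with a designated
output gate. Gates may be shared (arbitrary fan-out) and have unbounded fan-in. -/
structure BoolCircuit (n : ℕ) where
  /-- the number of gates -/
  size : ℕ
  /-- the predecessors of gate `i` are among the gates with number less than `i` -/
  gate : (i : Fin size) → CircuitGate n (i : ℕ)
  /-- the output gate -/
  output : Fin size

namespace BoolCircuit

/-- The value of gate `i` on input `x`. -/
def gateValue {n : ℕ} (c : BoolCircuit n) (x : Fin n → Bool) (i : Fin c.size) : Bool :=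
  match c.gate i with
  | .input a => x a
  | .not j => !(c.gateValue x ⟨j, j.isLt.trans i.isLt⟩)
  | .and J => decide (∀ j ∈ J, c.gateValue x ⟨j, j.isLt.trans i.isLt⟩ = true)
  | .or J => decide (∃ j ∈ J, c.gateValue x ⟨j, j.isLt.trans i.isLt⟩ = true)
termination_by (i : ℕ)
decreasing_by all_goals exact Fin.isLt _

/-- The depth of gate `i`: the length of a longest path from a source to gate `i`. -/
def gateDepth {n : ℕ} (c : BoolCircuit n) (i : Fin c.size) : ℕ :=
  match c.gate i with
  | .input _ => 0
  | .not j => c.gateDepth ⟨j, j.isLt.trans i.isLt⟩ + 1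
  | .and J => (J.sup fun j => c.gateDepth ⟨j, j.isLt.trans i.isLt⟩) + 1
  | .or J => (J.sup fun j => c.gateDepth ⟨j, j.isLt.trans i.isLt⟩) + 1
termination_by (i : ℕ)
decreasing_by all_goals exact Fin.isLt _

/-- The Boolean function computed by a circuit. -/
def eval {n : ℕ} (c : BoolCircuit n) (x : Fin n → Bool) : Bool := c.gateValue x c.output

/-- The depth of a circuit. -/
def depth {n : ℕ} (c : BoolCircuit n) : ℕ := c.gateDepth c.output

end BoolCircuit

/-- A family with one circuit for each input length. -/
abbrev CircuitFamily : Type := (n : ℕ) → BoolCircuit n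

/-- Constant depth and polynomial size. -/
def CircuitFamily.IsAC0 (C : CircuitFamily) : Prop :=
  (∃ D : ℕ, ∀ n, (C n).depth ≤ D) ∧ ∃ q : Polynomial ℕ, ∀ n, (C n).size ≤ q.eval n

/-- The language of all nonempty words accepted by the circuit for their length. -/
def CircuitFamily.language (C : CircuitFamily) : Language Bool :=
  {w : List Bool | w ≠ [] ∧ (C w.length).eval w.get = true}

/-- The languages of nonempty binary words that are accepted by an AC0 family of circuits. -/
def InAC0 (L : Language Bool) : Prop := ∃ C : CircuitFamily, C.IsAC0 ∧ L = C.language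

/-- The number of ones in a binary string. -/
def numOnes {n : ℕ} (x : Fin n → Bool) : ℕ := (Finset.univ.filter fun i => x i = true).card

/-- For every length `n ≥ 1` the circuit `C n` accepts all strings with at least `2n/3` ones and
rejects all strings with at most `n/3` ones. -/
def CircuitFamily.ApproximatesMajority (C : CircuitFamily) : Prop :=
  ∀ n : ℕ, 1 ≤ n → ∀ x : Fin n → Bool,
    ((2 * n / 3 : ℝ) ≤ numOnes x → (C n).eval x = true) ∧
    ((numOnes x : ℝ) ≤ (n / 3 : ℝ) → (C n).eval x = false)

/-!
Circuits of constant depth can approximate majority, but encoders with unique hard attention cannot,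
because fixing a small fraction of the input bits makes the output of an encoder constant.

*Encoders.* Call the sequence of values computed by some layers local on a subcube of the inputs
(`IsLocalOn`) if each position takes boundedly many values there and each value has a certificate of
boundedly many bits. The input is local. For one attention layer, consider a value `v` of an
attending position, and suppose that `v` can attend to more than `N` positions as the input varies
over the subcube. Rank the positions by the best score they can attain. Forcing any one of the first
`N` of them to take its best value, which costs boundedly many bits, leaves at most `N` positions to
which `v` can attend (`exists_forcing_pairs`). There are only `O(n)` pairs of a position and a value,
so by double counting, as long as many values are unresolved, some single pair resolves many of them
at once (`IsLocalOn.exists_subcube_unresolved`). With `N` a large constant this leaves a small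
fraction of the values unresolved at a small cost, and these are resolved one by one. When
every value can attend to at most `N` positions, the output of the layer is local again
(`IsLocalOn.attention`). So for every encoder and every `K`, fixing `n / K` bits makes the output
local (`UHAT.exists_isLocalOn`), and fixing one certificate more makes the output at position `0`
constant. A subcube with at most `n / 3` fixed bits contains strings with at least `2n / 3` ones and
strings with at most `n / 3` ones, so the encoder cannot separate them.

*Circuits.* Take a conjunction of `n` disjunctions of polynomially many conjunctions of `O(log n)`
variables, all chosen at random. If `p` is the fraction of ones in the input, the formula is true
with probability `(1 - (1 - p ^ k) ^ M) ^ n` (`uniformProb_formulaTrue`). For suitable `k` and `M`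
the error on inputs with `p ≥ 2 / 3` or `p ≤ 1 / 3` is below `2⁻ⁿ`, so by the union bound some
choice is correct on all of them (`exists_formula_approximating_majority`).
-/

/-! ### Least maximizers and subcubes -/

/-- Attention scores compared lexicographically, with the smaller position preferred in a tie. -/
def scoreKey {n : ℕ} (s : Fin n → ℝ) (j : Fin n) : ℝ ×ₗ (Fin n)ᵒᵈ :=
  toLex (s j, OrderDual.toDual j)

theorem eq_of_scoreKey_eq {n : ℕ} {s s' : Fin n → ℝ} {i j : Fin n}
    (h : scoreKey s i = scoreKey s' j) : i = j := by
  have := congrArg (fun p => OrderDual.ofDual (ofLex p).2) h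
  simpa [scoreKey] using this

theorem scoreKey_mono {n : ℕ} {s s' : Fin n → ℝ} {j : Fin n} (h : s j ≤ s' j) :
    scoreKey s j ≤ scoreKey s' j := by
  rw [scoreKey, scoreKey, Prod.Lex.toLex_le_toLex]
  rcases h.lt_or_eq with h | h
  · exact Or.inl h
  · exact Or.inr ⟨h, le_rfl⟩

theorem scoreKey_le_leastArgmax {n : ℕ} [Nonempty (Fin n)] (s : Fin n → ℝ) (k : Fin n) :
    scoreKey s k ≤ scoreKey s (leastArgmax s) := by
  have hmem := Finset.min'_mem (Finset.univ.filter fun j => ∀ k, s k ≤ s j) (by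
    obtain ⟨j, hj⟩ := Finite.exists_max s
    exact ⟨j, by simpa using hj⟩)
  have hmax : ∀ k, s k ≤ s (leastArgmax s) := (Finset.mem_filter.1 hmem).2
  rw [scoreKey, scoreKey, Prod.Lex.toLex_le_toLex]
  rcases (hmax k).lt_or_eq with h | h
  · exact Or.inl h
  · refine Or.inr ⟨h, OrderDual.toDual_le_toDual.2 (Finset.min'_le _ _ ?_)⟩
    simpa [h] using hmax

/-- The least maximizer is determined by the scores on any set of positions known to contain it. -/
theorem leastArgmax_congr {n : ℕ} [Nonempty (Fin n)] {s s' : Fin n → ℝ}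
    (h : s (leastArgmax s) = s' (leastArgmax s)) (h' : s (leastArgmax s') = s' (leastArgmax s')) :
    leastArgmax s = leastArgmax s' := by
  refine eq_of_scoreKey_eq (s := s) (s' := s) (le_antisymm ?_ (scoreKey_le_leastArgmax s _))
  exact (scoreKey_mono h.le).trans ((scoreKey_le_leastArgmax s' _).trans (scoreKey_mono h'.ge))

theorem Finset.exists_subset_card_eq_of_forall_lt {ι β : Type*} [DecidableEq ι] [LinearOrder β]
    (D : Finset ι) (key : ι → β) (hkey : Function.Injective key) (N : ℕ) (hN : N ≤ D.card) :
    ∃ T ⊆ D, T.card = N ∧ ∀ a ∈ T, ∀ b ∈ D, b ∉ T → key b < key a := by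
  induction N with
  | zero => exact ⟨∅, by simp⟩
  | succ N ih =>
    obtain ⟨T, hTD, hT, hlt⟩ := ih (by omega)
    have hne : (D \ T).Nonempty := by
      rw [← Finset.card_pos, Finset.card_sdiff_of_subset hTD]
      omega
    obtain ⟨a, ha, hmax⟩ := Finset.exists_max_image (D \ T) key hne
    obtain ⟨haD, haT⟩ := Finset.mem_sdiff.1 ha
    refine ⟨insert a T, Finset.insert_subset haD hTD, by simp [haT, hT], ?_⟩
    intro c hc b hb hbT
    simp only [Finset.mem_insert, not_or] at hc hbT
    rcases hc with rfl | hc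
    · exact lt_of_le_of_ne (hmax b (by simp [hb, hbT.2])) (fun h => hbT.1 (hkey h))
    · exact hlt c hc b hb hbT.2

theorem Set.Finite.card_toFinset_eq_ncard {α : Type*} {s : Set α} (hs : s.Finite) :
    hs.toFinset.card = s.ncard :=
  (Set.ncard_eq_toFinset_card s hs).symm

/-- The subcube of all inputs that agree with `x` on the coordinates in `R`. -/
def subcube {ι : Type*} (R : Finset ι) (x : ι → Bool) : Set (ι → Bool) :=
  {y | ∀ k ∈ R, y k = x k}

theorem self_mem_subcube {ι : Type*} (R : Finset ι) (x : ι → Bool) : x ∈ subcube R x :=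
  fun _ _ => rfl

theorem subcube_subset {ι : Type*} {R R' : Finset ι} {x x' : ι → Bool} (hR : R ⊆ R')
    (hx : x' ∈ subcube R x) : subcube R' x' ⊆ subcube R x :=
  fun _ hy k hk => (hy k (hR hk)).trans (hx k hk)

/-- On the set `Q` of inputs, every component of `u` takes at most `m` values, and each value it
takes is forced, within `Q`, by at most `c` input bits. -/
def IsLocalOn {n : ℕ} {V : Type*} (u : (Fin n → Bool) → Fin n → V) (m c : ℕ)
    (Q : Set (Fin n → Bool)) : Prop :=
  ∀ i, ((fun x => u x i) '' Q).ncard ≤ m ∧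
    ∀ x ∈ Q, ∃ S : Finset (Fin n), S.card ≤ c ∧
      ∀ y ∈ Q, (∀ k ∈ S, y k = x k) → u y i = u x i

theorem IsLocalOn.mono {n : ℕ} {V : Type*} {u : (Fin n → Bool) → Fin n → V} {m c : ℕ}
    {Q Q' : Set (Fin n → Bool)} (h : IsLocalOn u m c Q) (hQ : Q' ⊆ Q) : IsLocalOn u m c Q' := by
  refine fun i => ⟨(Set.ncard_le_ncard (Set.image_mono hQ) (Set.toFinite _)).trans (h i).1, ?_⟩
  intro x hx
  obtain ⟨S, hS, hSu⟩ := (h i).2 x (hQ hx)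
  exact ⟨S, hS, fun y hy => hSu y (hQ hy)⟩

/-- Restricting few further bits makes one component of a local function constant. -/
theorem IsLocalOn.exists_subcube {n : ℕ} {V : Type*} {u : (Fin n → Bool) → Fin n → V} {m c : ℕ}
    {R : Finset (Fin n)} {x : Fin n → Bool} (h : IsLocalOn u m c (subcube R x)) (j : Fin n)
    {z : Fin n → Bool} (hz : z ∈ subcube R x) :
    ∃ R' : Finset (Fin n), R'.card ≤ R.card + c ∧ subcube R' z ⊆ subcube R x ∧
      ∀ y ∈ subcube R' z, u y j = u z j := by
  classical
  obtain ⟨S, hS, hSu⟩ := (h j).2 z hz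
  have hsub : subcube (R ∪ S) z ⊆ subcube R x := subcube_subset Finset.subset_union_left hz
  refine ⟨R ∪ S, (Finset.card_union_le _ _).trans (by omega), hsub, fun y hy => ?_⟩
  exact hSu y (hsub hy) fun k hk => hy k (Finset.mem_union_right _ hk)

/-! ### Restrictions that localize one attention layer -/

/-- The position attended to on input `x` from a position with value `v`, where `score` is the
attention score and `u` gives the values at all positions. -/
noncomputable def attended {n : ℕ} [Nonempty (Fin n)] {V : Type*} (score : V → V → ℝ)
    (u : (Fin n → Bool) → Fin n → V) (v : V) (x : Fin n → Bool) : Fin n :=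
  leastArgmax fun j => score v (u x j)

/-- The pairs of a position and a value that it takes on some input in `Q`. -/
noncomputable def valuePairs {n : ℕ} {V : Type*} (u : (Fin n → Bool) → Fin n → V)
    (Q : Set (Fin n → Bool)) : Finset (Fin n × V) :=
  (show Set.Finite {p : Fin n × V | ∃ x ∈ Q, u x p.1 = p.2} from
    (Set.toFinite (Set.range fun q : (Fin n → Bool) × Fin n => (q.2, u q.1 q.2))).subset (by
      rintro ⟨i, v⟩ ⟨x, -, hx⟩
      exact ⟨(x, i), Prod.ext rfl hx⟩)).toFinset

theorem mem_valuePairs {n : ℕ} {V : Type*} {u : (Fin n → Bool) → Fin n → V}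
    {Q : Set (Fin n → Bool)} {p : Fin n × V} :
    p ∈ valuePairs u Q ↔ ∃ x ∈ Q, u x p.1 = p.2 := by
  simp [valuePairs]

theorem IsLocalOn.card_valuePairs_le {n : ℕ} {V : Type*} {u : (Fin n → Bool) → Fin n → V}
    {m c : ℕ} {Q : Set (Fin n → Bool)} (h : IsLocalOn u m c Q) :
    (valuePairs u Q).card ≤ n * m := by
  classical
  have hsub : valuePairs u Q ⊆ Finset.univ.biUnion fun i : Fin n =>
      (Set.toFinite ((fun x => u x i) '' Q)).toFinset.image fun v => (i, v) := by
    rintro ⟨i, v⟩ hp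
    obtain ⟨x, hx, hv⟩ := mem_valuePairs.1 hp
    simp only [Finset.mem_biUnion, Finset.mem_univ, true_and]
    exact ⟨i, Finset.mem_image.2 ⟨v, by simpa using ⟨x, hx, hv⟩, rfl⟩⟩
  refine (Finset.card_le_card hsub).trans ((Finset.card_biUnion_le_card_mul _ _ m ?_).trans
    (by simp))
  intro i _
  refine Finset.card_image_le.trans ?_
  rw [Set.Finite.card_toFinset_eq_ncard]
  exact (h i).1

/-- If a value `v` can attend to more than `N` positions, then there are `N` pairs `(j, w)` such
that forcing position `j` to have the value `w` leaves at most `N` positions for `v` to attend to.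
They are formed by the `N` positions with the best attainable scores, and their best values. -/
theorem exists_forcing_pairs {n : ℕ} [Nonempty (Fin n)] {V : Type*} (score : V → V → ℝ)
    (u : (Fin n → Bool) → Fin n → V) (v : V) (N : ℕ) {Q : Set (Fin n → Bool)}
    (hN : N < (attended score u v '' Q).ncard) :
    ∃ P : Finset (Fin n × V), P.card = N ∧ P ⊆ valuePairs u Q ∧
      ∀ p ∈ P, ∀ Q' ⊆ Q, (∀ y ∈ Q', u y p.1 = p.2) → (attended score u v '' Q').ncard ≤ N := by
  classical
  have hne : Q.Nonempty := by
    by_contra hQ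
    rw [Set.not_nonempty_iff_eq_empty] at hQ
    simp [hQ] at hN
  have hbest : ∀ j, ∃ x ∈ Q, ∀ y ∈ Q, score v (u y j) ≤ score v (u x j) := fun j =>
    Set.exists_max_image Q (fun x => score v (u x j)) (Set.toFinite Q) hne
  choose b hbQ hb using hbest
  have hNn : N ≤ (Finset.univ : Finset (Fin n)).card := by
    refine hN.le.trans ((Set.ncard_le_ncard (Set.subset_univ _)).trans ?_)
    simp [Set.ncard_univ]
  obtain ⟨T, -, hT, hlt⟩ := Finset.univ.exists_subset_card_eq_of_forall_lt
    (scoreKey fun j => score v (u (b j) j)) (fun _ _ h => eq_of_scoreKey_eq h) N hNn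
  refine ⟨T.image fun j => (j, u (b j) j), ?_, ?_, ?_⟩
  · rw [Finset.card_image_of_injective _ fun i j h => congrArg Prod.fst h, hT]
  · intro p hp
    obtain ⟨j, -, rfl⟩ := Finset.mem_image.1 hp
    exact mem_valuePairs.2 ⟨b j, hbQ j, rfl⟩
  · intro p hp Q' hQ' hforce
    obtain ⟨j, hj, rfl⟩ := Finset.mem_image.1 hp
    rw [← hT, ← Set.ncard_coe_finset]
    refine Set.ncard_le_ncard ?_ (Set.toFinite _)
    rintro _ ⟨y, hy, rfl⟩
    by_contra hnot
    refine (hlt j hj _ (Finset.mem_univ _) hnot).not_ge ?_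
    -- on `y`, position `j` has its best score, and the attended position beats it
    calc scoreKey (fun j => score v (u (b j) j)) j
        ≤ scoreKey (fun j => score v (u y j)) j := scoreKey_mono (by simp [hforce y hy])
      _ ≤ scoreKey (fun j => score v (u y j)) (attended score u v y) :=
          scoreKey_le_leastArgmax _ _
      _ ≤ _ := scoreKey_mono (hb _ y (hQ' hy))

open Classical in
/-- The pairs in `W` whose value can attend to more than `N` positions on inputs in `Q`. -/
noncomputable def unresolved {n : ℕ} [Nonempty (Fin n)] {V : Type*} (score : V → V → ℝ)
    (u : (Fin n → Bool) → Fin n → V) (W : Finset (Fin n × V)) (N : ℕ)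
    (Q : Set (Fin n → Bool)) : Finset (Fin n × V) :=
  W.filter fun f => N < (attended score u f.2 '' Q).ncard

theorem unresolved_subset {n : ℕ} [Nonempty (Fin n)] {V : Type*} (score : V → V → ℝ)
    (u : (Fin n → Bool) → Fin n → V) (W : Finset (Fin n × V)) (N : ℕ)
    {Q Q' : Set (Fin n → Bool)} (h : Q' ⊆ Q) :
    unresolved score u W N Q' ⊆ unresolved score u W N Q := by
  intro f hf
  simp only [unresolved, Finset.mem_filter] at hf ⊢
  exact ⟨hf.1, hf.2.trans_le (Set.ncard_le_ncard (Set.image_mono h) (Set.toFinite _))⟩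

/-- Fixing `c` bits resolves at least one pair, and at least `r` pairs as long as many pairs are
unresolved: by double counting, some pair then forces `r` of the unresolved ones. -/
theorem IsLocalOn.exists_subcube_unresolved {n : ℕ} [Nonempty (Fin n)] {V : Type*}
    (score : V → V → ℝ) {u : (Fin n → Bool) → Fin n → V} {m c r : ℕ} (hr : 0 < r)
    (W : Finset (Fin n × V)) {R : Finset (Fin n)} {x : Fin n → Bool}
    (h : IsLocalOn u m c (subcube R x))
    (hU : 0 < (unresolved score u W (r * r) (subcube R x)).card) :
    ∃ (R' : Finset (Fin n)) (x' : Fin n → Bool), R'.card ≤ R.card + c ∧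
      subcube R' x' ⊆ subcube R x ∧
      (unresolved score u W (r * r) (subcube R' x')).card <
        (unresolved score u W (r * r) (subcube R x)).card ∧
      (n * m < r * (unresolved score u W (r * r) (subcube R x)).card →
        (unresolved score u W (r * r) (subcube R' x')).card + r ≤
          (unresolved score u W (r * r) (subcube R x)).card) := by
  classical
  set Q := subcube R x with hQ
  set U := unresolved score u W (r * r) Q with hUdef
  have hforce : ∀ f ∈ U, ∃ P : Finset (Fin n × V), P.card = r * r ∧ P ⊆ valuePairs u Q ∧
      ∀ p ∈ P, ∀ Q' ⊆ Q, (∀ y ∈ Q', u y p.1 = p.2) →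
        (attended score u f.2 '' Q').ncard ≤ r * r := fun f hf =>
    exists_forcing_pairs score u f.2 (r * r) (Finset.mem_filter.1 hf).2
  choose! P hPcard hPsub hPforce using hforce
  -- choose the pair that forces the most unresolved ones
  obtain ⟨f₀, hf₀⟩ := Finset.card_pos.1 hU
  have hne : (valuePairs u Q).Nonempty := by
    have : (P f₀).Nonempty := by
      rw [← Finset.card_pos, hPcard f₀ hf₀]
      positivity
    exact this.mono (hPsub f₀ hf₀)
  obtain ⟨p, hp, hmax⟩ := Finset.exists_max_image (valuePairs u Q)
    (fun p => (U.filter fun f => p ∈ P f).card) hne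
  have hcount : U.card * (r * r) ≤ n * m * (U.filter fun f => p ∈ P f).card := by
    calc U.card * (r * r) = ∑ f ∈ U, ((valuePairs u Q).filter fun q => q ∈ P f).card := by
          rw [Finset.sum_const_nat]
          intro f hf
          rw [Finset.filter_mem_eq_inter, Finset.inter_eq_right.2 (hPsub f hf), hPcard f hf]
      _ = ∑ q ∈ valuePairs u Q, (U.filter fun f => q ∈ P f).card :=
          Finset.sum_card_bipartiteAbove_eq_sum_card_bipartiteBelow (fun f q => q ∈ P f)
      _ ≤ (valuePairs u Q).card * (U.filter fun f => p ∈ P f).card :=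
          (Finset.sum_le_card_nsmul _ _ _ hmax).trans (by simp)
      _ ≤ _ := Nat.mul_le_mul_right _ h.card_valuePairs_le
  obtain ⟨z, hz, hzp⟩ := mem_valuePairs.1 hp
  obtain ⟨R', hR', hsub, hconst⟩ := h.exists_subcube p.1 hz
  have hle : (unresolved score u W (r * r) (subcube R' z)).card +
      (U.filter fun f => p ∈ P f).card ≤ U.card := by
    rw [← Finset.card_union_of_disjoint]
    · exact Finset.card_le_card
        (Finset.union_subset (unresolved_subset score u W _ hsub) (Finset.filter_subset _ _))
    · rw [Finset.disjoint_left]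
      intro f hf hf'
      obtain ⟨hfU, hfp⟩ := Finset.mem_filter.1 hf'
      refine (Finset.mem_filter.1 hf).2.not_ge (hPforce f hfU p hfp _ hsub ?_)
      exact fun y hy => (hconst y hy).trans hzp
  have hpos : 0 < (U.filter fun f => p ∈ P f).card := by
    refine Nat.pos_of_ne_zero fun h0 => ?_
    rw [h0, mul_zero] at hcount
    have : 0 < U.card * (r * r) := by positivity
    omega
  refine ⟨R', z, hR', hsub, by omega, fun hlarge => ?_⟩
  have : r ≤ (U.filter fun f => p ∈ P f).card := by
    by_contra hlt
    have h1 := Nat.mul_le_mul_left (n * m) (not_le.1 hlt).le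
    have h2 := Nat.mul_lt_mul_of_pos_right hlarge hr
    have h3 : r * U.card * r = U.card * (r * r) := by ring
    omega
  omega

/-- As long as more than `n * m / r` pairs are unresolved, every `c` bits resolve `r` of them. -/
theorem IsLocalOn.exists_unresolved_le {n : ℕ} [Nonempty (Fin n)] {V : Type*}
    (score : V → V → ℝ) {u : (Fin n → Bool) → Fin n → V} {m c r : ℕ} (hr : 0 < r)
    (W : Finset (Fin n × V)) (U : ℕ) {R : Finset (Fin n)} {x : Fin n → Bool}
    (h : IsLocalOn u m c (subcube R x))
    (hU : (unresolved score u W (r * r) (subcube R x)).card = U) :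
    ∃ (R' : Finset (Fin n)) (x' : Fin n → Bool), subcube R' x' ⊆ subcube R x ∧
      r * R'.card ≤ r * R.card + c * U ∧
      r * (unresolved score u W (r * r) (subcube R' x')).card ≤ n * m := by
  induction U using Nat.strong_induction_on generalizing R x with
  | _ U ih =>
    by_cases hsmall : r * U ≤ n * m
    · exact ⟨R, x, subset_rfl, by omega, by rwa [hU]⟩
    · have hpos : 0 < U := Nat.pos_of_ne_zero (by rintro rfl; simp at hsmall)
      obtain ⟨R₁, x₁, hR₁, hsub₁, hlt, hle⟩ :=
        h.exists_subcube_unresolved score hr W (by rwa [hU])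
      rw [hU] at hlt hle
      obtain ⟨R₂, x₂, hsub₂, hR₂, hU₂⟩ := ih _ hlt (h.mono hsub₁) rfl
      refine ⟨R₂, x₂, hsub₂.trans hsub₁, ?_, hU₂⟩
      have := hle (by omega)
      nlinarith

/-- All unresolved pairs can be resolved one by one, at a cost of `c` bits each. -/
theorem IsLocalOn.exists_unresolved_eq_empty {n : ℕ} [Nonempty (Fin n)] {V : Type*}
    (score : V → V → ℝ) {u : (Fin n → Bool) → Fin n → V} {m c r : ℕ} (hr : 0 < r)
    (W : Finset (Fin n × V)) (U : ℕ) {R : Finset (Fin n)} {x : Fin n → Bool}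
    (h : IsLocalOn u m c (subcube R x))
    (hU : (unresolved score u W (r * r) (subcube R x)).card = U) :
    ∃ (R' : Finset (Fin n)) (x' : Fin n → Bool), subcube R' x' ⊆ subcube R x ∧
      R'.card ≤ R.card + c * U ∧ unresolved score u W (r * r) (subcube R' x') = ∅ := by
  induction U using Nat.strong_induction_on generalizing R x with
  | _ U ih =>
    rcases Nat.eq_zero_or_pos U with rfl | hpos
    · exact ⟨R, x, subset_rfl, by omega, Finset.card_eq_zero.1 hU⟩
    · obtain ⟨R₁, x₁, hR₁, hsub₁, hlt, -⟩ :=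
        h.exists_subcube_unresolved score hr W (by rwa [hU])
      rw [hU] at hlt
      obtain ⟨R₂, x₂, hsub₂, hR₂, hU₂⟩ := ih _ hlt (h.mono hsub₁) rfl
      refine ⟨R₂, x₂, hsub₂.trans hsub₁, ?_, hU₂⟩
      nlinarith

/-- When every value can attend to at most `N` positions, an attention layer preserves locality:
a certificate for the attended position consists of certificates for all these positions. -/
theorem IsLocalOn.attention {n : ℕ} [Nonempty (Fin n)] {V V' : Type*} (score : V → V → ℝ)
    (G : V → V → V') {u : (Fin n → Bool) → Fin n → V} {m c N : ℕ} {Q : Set (Fin n → Bool)}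
    (h : IsLocalOn u m c Q)
    (hN : ∀ x ∈ Q, ∀ i, (attended score u (u x i) '' Q).ncard ≤ N) :
    IsLocalOn (fun x i => G (u x i) (u x (attended score u (u x i) x)))
      (m * (N * m)) (c + N * c) Q := by
  classical
  intro i
  constructor
  · have hsub : ((fun x => G (u x i) (u x (attended score u (u x i) x))) '' Q) ⊆
        ((Set.toFinite ((fun x => u x i) '' Q)).toFinset.biUnion fun v =>
          (Set.toFinite (attended score u v '' Q)).toFinset.biUnion fun j =>
            (Set.toFinite ((fun x => u x j) '' Q)).toFinset.image (G v) : Finset V') := by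
      rintro _ ⟨x, hx, rfl⟩
      simp only [Finset.coe_biUnion, Set.Finite.coe_toFinset, Set.mem_iUnion, Finset.coe_image]
      exact ⟨u x i, ⟨x, hx, rfl⟩, _, ⟨x, hx, rfl⟩, _, ⟨x, hx, rfl⟩, rfl⟩
    refine (Set.ncard_le_ncard hsub (Finset.finite_toSet _)).trans ?_
    rw [Set.ncard_coe_finset]
    refine (Finset.card_biUnion_le_card_mul _ _ (N * m) ?_).trans ?_
    · intro v hv
      obtain ⟨x, hx, rfl⟩ := (Set.Finite.mem_toFinset _).1 hv
      refine (Finset.card_biUnion_le_card_mul _ _ m ?_).trans ?_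
      · intro j _
        refine Finset.card_image_le.trans ?_
        rw [Set.Finite.card_toFinset_eq_ncard]
        exact (h j).1
      · rw [Set.Finite.card_toFinset_eq_ncard]
        exact Nat.mul_le_mul_right _ (hN x hx i)
    · rw [Set.Finite.card_toFinset_eq_ncard]
      exact Nat.mul_le_mul_right _ (h i).1
  · intro x hx
    have hcert : ∀ j, ∃ S : Finset (Fin n), S.card ≤ c ∧
        ∀ y ∈ Q, (∀ k ∈ S, y k = x k) → u y j = u x j := fun j => (h j).2 x hx
    choose S hS hSu using hcert
    set D := (Set.toFinite (attended score u (u x i) '' Q)).toFinset with hD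
    have hmem : ∀ y ∈ Q, attended score u (u x i) y ∈ D := fun y hy =>
      (Set.Finite.mem_toFinset _).2 ⟨y, hy, rfl⟩
    refine ⟨S i ∪ D.biUnion S, ?_, fun y hy hyx => ?_⟩
    · refine (Finset.card_union_le _ _).trans (Nat.add_le_add (hS i) ?_)
      refine (Finset.card_biUnion_le_card_mul _ _ c fun j _ => hS j).trans ?_
      rw [hD, Set.Finite.card_toFinset_eq_ncard]
      exact Nat.mul_le_mul_right _ (hN x hx i)
    · have hi : u y i = u x i := hSu i y hy fun k hk => hyx k (Finset.mem_union_left _ hk)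
      have hj : ∀ j ∈ D, u y j = u x j := fun j hj => hSu j y hy fun k hk =>
        hyx k (Finset.mem_union_right _ (Finset.mem_biUnion.2 ⟨j, hj, hk⟩))
      have hatt : attended score u (u x i) y = attended score u (u x i) x :=
        leastArgmax_congr (congrArg _ (hj _ (hmem y hy))) (congrArg _ (hj _ (hmem x hx)))
      simp only [hi, hatt, hj _ (hmem x hx)]

/-- A restriction of few bits keeps the output of an attention layer local. The bits are spent in
equal parts on resolving many values at a time and on resolving the remaining ones individually. -/
theorem IsLocalOn.exists_attention {n : ℕ} [Nonempty (Fin n)] {V V' : Type*}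
    (score : V → V → ℝ) (G : V → V → V') {u : (Fin n → Bool) → Fin n → V} {m c r : ℕ}
    (hr : 0 < r) {R : Finset (Fin n)} {x : Fin n → Bool} (h : IsLocalOn u m c (subcube R x)) :
    ∃ (R' : Finset (Fin n)) (x' : Fin n → Bool),
      r * R'.card ≤ r * R.card + 2 * c * m * n ∧
      IsLocalOn (fun x i => G (u x i) (u x (attended score u (u x i) x)))
        (m * (r * r * m)) (c + r * r * c) (subcube R' x') := by
  set W := valuePairs u (subcube R x) with hW
  obtain ⟨R₁, x₁, hsub₁, hR₁, hU₁⟩ := h.exists_unresolved_le score hr W _ rfl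
  obtain ⟨R₂, x₂, hsub₂, hR₂, hU₂⟩ :=
    (h.mono hsub₁).exists_unresolved_eq_empty score hr W _ rfl
  have hsub := hsub₂.trans hsub₁
  refine ⟨R₂, x₂, ?_, (h.mono hsub).attention score G fun y hy i => ?_⟩
  · have hcard : (unresolved score u W (r * r) (subcube R x)).card ≤ n * m :=
      (Finset.card_filter_le _ _).trans h.card_valuePairs_le
    calc r * R₂.card ≤ r * R₁.card + c * (r * _) := by
          rw [mul_left_comm, ← mul_add]; exact Nat.mul_le_mul_left _ hR₂
      _ ≤ (r * R.card + c * (n * m)) + c * (n * m) :=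
          Nat.add_le_add (hR₁.trans (Nat.add_le_add_left (Nat.mul_le_mul_left _ hcard) _))
            (Nat.mul_le_mul_left _ hU₁)
      _ = _ := by ring
  · by_contra hlt
    have : (i, u y i) ∈ unresolved score u W (r * r) (subcube R₂ x₂) := by
      simp only [unresolved, Finset.mem_filter, hW, mem_valuePairs]
      exact ⟨⟨y, hsub hy, rfl⟩, not_le.1 hlt⟩
    rw [hU₂] at this
    exact absurd this (Finset.notMem_empty _)

theorem IsLocalOn.map {n : ℕ} {V V' : Type*} (g : V → V') {u : (Fin n → Bool) → Fin n → V}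
    {m c : ℕ} {Q : Set (Fin n → Bool)} (h : IsLocalOn u m c Q) :
    IsLocalOn (fun x i => g (u x i)) m c Q := by
  refine fun i => ⟨?_, fun x hx => ?_⟩
  · rw [← Set.image_image g]
    exact (Set.ncard_image_le (Set.toFinite _)).trans (h i).1
  · obtain ⟨S, hS, hSu⟩ := (h i).2 x hx
    exact ⟨S, hS, fun y hy hyx => congrArg g (hSu y hy hyx)⟩

/-! ### Encoders and approximate majority -/

/-- Fixing an arbitrarily small fraction of the input bits keeps a layer's output local, with
parameters that do not depend on the input length. -/
theorem EncoderLayer.exists_isLocalOn {d e : ℕ} (layer : EncoderLayer d e) (K m c : ℕ) :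
    ∃ m' c' : ℕ, ∀ (n : ℕ) (u : (Fin n → Bool) → Fin n → Fin d → ℝ) (R : Finset (Fin n))
      (x : Fin n → Bool), 0 < n → IsLocalOn u m c (subcube R x) →
      ∃ (R' : Finset (Fin n)) (x' : Fin n → Bool), K * R'.card ≤ K * R.card + n ∧
        IsLocalOn (fun x => layer.apply (u x)) m' c' (subcube R' x') := by
  cases layer with
  | standard A B C =>
    -- with this `r`, the at most `2 * c * m * n / r` new bits are at most `n / K`
    set r := 2 * c * m * K + 1 with hr
    refine ⟨m * (r * r * m), c + r * r * c, fun n u R x hn h => ?_⟩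
    have : Nonempty (Fin n) := ⟨⟨0, hn⟩⟩
    obtain ⟨R', x', hR', hlocal⟩ := h.exists_attention (fun v w => A v ⬝ᵥ B w)
      (fun v w => C (v, w)) (r := r) (by omega)
    refine ⟨R', x', ?_, hlocal⟩
    have h1 : r * (K * R'.card) ≤ r * (K * R.card) + (2 * c * m * K) * n := by
      calc r * (K * R'.card) = K * (r * R'.card) := by ring
        _ ≤ K * (r * R.card + 2 * c * m * n) := Nat.mul_le_mul_left _ hR'
        _ = _ := by ring
    have h2 : (2 * c * m * K) * n ≤ r * n := Nat.mul_le_mul_right _ (by omega)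
    refine Nat.le_of_mul_le_mul_left (c := r) ?_ (by omega)
    rw [mul_add]
    omega
  | relu k =>
    exact ⟨m, c, fun n u R x _ h => ⟨R, x, by omega,
      h.map fun v => Function.update v k (max 0 (v k))⟩⟩

/-- The fraction `1 / K` of bits is split evenly between the first layer and the remaining ones. -/
theorem UHAT.exists_isLocalOn {d e : ℕ} (T : UHAT d e) (K m c : ℕ) :
    ∃ m' c' : ℕ, ∀ (n : ℕ) (u : (Fin n → Bool) → Fin n → Fin d → ℝ) (R : Finset (Fin n))
      (x : Fin n → Bool), 0 < n → IsLocalOn u m c (subcube R x) →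
      ∃ (R' : Finset (Fin n)) (x' : Fin n → Bool), K * R'.card ≤ K * R.card + n ∧
        IsLocalOn (fun x => T.apply (u x)) m' c' (subcube R' x') := by
  induction T generalizing K m c with
  | nil d => exact ⟨m, c, fun n u R x _ h => ⟨R, x, by omega, h⟩⟩
  | cons layer rest ih =>
    obtain ⟨m₁, c₁, h₁⟩ := layer.exists_isLocalOn (2 * K) m c
    obtain ⟨m₂, c₂, h₂⟩ := ih (2 * K) m₁ c₁
    refine ⟨m₂, c₂, fun n u R x hn h => ?_⟩
    obtain ⟨R₁, x₁, hR₁, hl₁⟩ := h₁ n u R x hn h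
    obtain ⟨R₂, x₂, hR₂, hl₂⟩ := h₂ n _ R₁ x₁ hn hl₁
    refine ⟨R₂, x₂, ?_, hl₂⟩
    rw [mul_assoc] at hR₁ hR₂
    rw [mul_assoc] at hR₁ hR₂
    omega

/-- For some `n`, fixing at most a third of the `n` input bits makes the output of an encoder at
position `0` constant. -/
theorem UHAT.exists_subcube_constant {d e : ℕ} (T : UHAT d e) (emb : Bool → Fin d → ℝ)
    (p : ℕ → ℕ → Fin d → ℝ) :
    ∃ (n : ℕ) (hn : 0 < n) (R : Finset (Fin n)) (x : Fin n → Bool), 3 * R.card ≤ n ∧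
      ∀ y ∈ subcube R x, T.apply (fun i : Fin n => emb (y i) + p i n) ⟨0, hn⟩ =
        T.apply (fun i : Fin n => emb (x i) + p i n) ⟨0, hn⟩ := by
  -- a sixth of the bits makes the output local, and another sixth pays for one certificate
  obtain ⟨m, c, h⟩ := T.exists_isLocalOn 6 2 1
  set n := 6 * c + 1 with hn
  have hinit : IsLocalOn (fun (x : Fin n → Bool) i => emb (x i) + p i n) 2 1
      (subcube ∅ fun _ => false) := by
    refine fun i => ⟨?_, fun x _ => ⟨{i}, by simp, fun y _ hy => by simp [hy]⟩⟩
    have hsub : ((fun x : Fin n → Bool => emb (x i) + p i n) '' subcube ∅ fun _ => false) ⊆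
        (fun b : Bool => emb b + p i n) '' Set.univ := by
      rintro _ ⟨x, -, rfl⟩
      exact ⟨x i, trivial, rfl⟩
    refine (Set.ncard_le_ncard hsub (Set.toFinite _)).trans ((Set.ncard_image_le (Set.toFinite _)).trans ?_)
    simp
  obtain ⟨R, x, hR, hlocal⟩ := h n _ ∅ _ (by omega) hinit
  obtain ⟨R', hR', -, hconst⟩ :=
    hlocal.exists_subcube ⟨0, by omega⟩ (self_mem_subcube R x)
  refine ⟨n, by omega, R', x, ?_, hconst⟩
  rw [Finset.card_empty] at hR
  omega

/-- The value of an encoder on the word with letters `x i`, without the casts along the length of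
the word. -/
theorem UHAT.value_ofFn {d e : ℕ} (T : UHAT d e) (emb : Bool → Fin d → ℝ)
    (p : ℕ → ℕ → Fin d → ℝ) (t : Fin e → ℝ) {n : ℕ} (hn : 0 < n) (x : Fin n → Bool)
    (hw : List.ofFn x ≠ []) :
    T.value emb p t (List.ofFn x) hw =
      t ⬝ᵥ T.apply (fun i : Fin n => emb (x i) + p i n) ⟨0, hn⟩ := by
  have key : ∀ (w : List Bool) (hw : w ≠ []) (hl : w.length = n),
      (∀ i : Fin n, w.get (i.cast hl.symm) = x i) →
      T.value emb p t w hw = t ⬝ᵥ T.apply (fun i : Fin n => emb (x i) + p i n) ⟨0, hn⟩ := by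
    intro w hw hl hx
    subst hl
    have : w.get = x := funext hx
    rw [← this]
    rfl
  exact key _ hw (by simp) (by simp)

theorem CircuitFamily.ofFn_mem_language {C : CircuitFamily} {n : ℕ} (hn : 0 < n)
    (x : Fin n → Bool) : List.ofFn x ∈ C.language ↔ (C n).eval x = true := by
  have key : ∀ (w : List Bool) (hl : w.length = n), (∀ i : Fin n, w.get (i.cast hl.symm) = x i) →
      (w ∈ C.language ↔ (C n).eval x = true) := by
    intro w hl hx
    subst hl
    have : w.get = x := funext hx
    rw [← this]
    exact ⟨fun h => h.2, fun h => ⟨List.length_pos_iff.1 hn, h⟩⟩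
  exact key _ (by simp) (by simp)

/-- The subcube on which the output at position `0` is constant contains strings with at most a
third of ones and strings with at least two thirds of ones. -/
theorem CircuitFamily.ApproximatesMajority.not_accepts {C : CircuitFamily}
    (hC : C.ApproximatesMajority) {d e : ℕ} (T : UHAT d e) : ¬ T.Accepts C.language := by
  classical
  rintro ⟨emb, p, t, hacc⟩
  obtain ⟨n, hn, R, x, hR, hconst⟩ := T.exists_subcube_constant emb p
  have hRn : (3 : ℝ) * R.card ≤ n := by exact_mod_cast hR
  set y₁ : Fin n → Bool := fun i => if i ∈ R then x i else true with hy₁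
  set y₀ : Fin n → Bool := fun i => if i ∈ R then x i else false with hy₀
  have hmem₁ : y₁ ∈ subcube R x := fun k hk => by simp [hy₁, hk]
  have hmem₀ : y₀ ∈ subcube R x := fun k hk => by simp [hy₀, hk]
  have hones₁ : (2 * n / 3 : ℝ) ≤ numOnes y₁ := by
    have hsub : Rᶜ ⊆ Finset.univ.filter fun i => y₁ i = true := by
      intro i hi
      simp [hy₁, Finset.mem_compl.1 hi]
    have := Finset.card_le_card hsub
    rw [Finset.card_compl, Fintype.card_fin] at this
    have h' : (n : ℝ) ≤ numOnes y₁ + R.card := by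
      exact_mod_cast (by unfold numOnes; omega : n ≤ numOnes y₁ + R.card)
    linarith
  have hones₀ : (numOnes y₀ : ℝ) ≤ n / 3 := by
    have hsub : (Finset.univ.filter fun i => y₀ i = true) ⊆ R := by
      intro i hi
      by_contra hiR
      simp [hy₀, hiR] at hi
    have : (numOnes y₀ : ℝ) ≤ R.card := by exact_mod_cast Finset.card_le_card hsub
    linarith
  have hne : ∀ y : Fin n → Bool, List.ofFn y ≠ [] := fun y => by
    rw [← List.length_pos_iff]
    simpa using hn
  have hpos := (hacc _ (hne y₁)).1
    ((CircuitFamily.ofFn_mem_language hn y₁).2 ((hC n hn y₁).1 hones₁))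
  have hneg := (hacc _ (hne y₀)).2 fun h => by
    rw [CircuitFamily.ofFn_mem_language hn, (hC n hn y₀).2 hones₀] at h
    exact absurd h (by simp)
  rw [T.value_ofFn emb p t hn, hconst _ hmem₁] at hpos
  rw [T.value_ofFn emb p t hn, hconst _ hmem₀] at hneg
  exact lt_asymm hpos hneg

/-! ### Depth-three circuits -/

namespace BoolCircuit

theorem gateValue_of_input {n : ℕ} {c : BoolCircuit n} {x : Fin n → Bool} {i : Fin c.size}
    {a : Fin n} (h : c.gate i = .input a) : c.gateValue x i = x a := by
  rw [gateValue, h]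

theorem gateValue_of_and {n : ℕ} {c : BoolCircuit n} {x : Fin n → Bool} {i : Fin c.size}
    {J : Finset (Fin i)} (h : c.gate i = .and J) :
    c.gateValue x i = true ↔ ∀ j ∈ J, c.gateValue x ⟨j, j.isLt.trans i.isLt⟩ = true := by
  rw [gateValue, h]
  simp

theorem gateValue_of_or {n : ℕ} {c : BoolCircuit n} {x : Fin n → Bool} {i : Fin c.size}
    {J : Finset (Fin i)} (h : c.gate i = .or J) :
    c.gateValue x i = true ↔ ∃ j ∈ J, c.gateValue x ⟨j, j.isLt.trans i.isLt⟩ = true := by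
  rw [gateValue, h]
  simp

theorem gateDepth_of_input {n : ℕ} {c : BoolCircuit n} {i : Fin c.size} {a : Fin n}
    (h : c.gate i = .input a) : c.gateDepth i = 0 := by
  rw [gateDepth, h]

theorem gateDepth_of_and_le {n : ℕ} {c : BoolCircuit n} {i : Fin c.size} {J : Finset (Fin i)}
    (h : c.gate i = .and J) {D : ℕ}
    (hJ : ∀ j ∈ J, c.gateDepth ⟨j, j.isLt.trans i.isLt⟩ ≤ D) : c.gateDepth i ≤ D + 1 := by
  rw [gateDepth, h]
  exact Nat.succ_le_succ (Finset.sup_le hJ)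

theorem gateDepth_of_or_le {n : ℕ} {c : BoolCircuit n} {i : Fin c.size} {J : Finset (Fin i)}
    (h : c.gate i = .or J) {D : ℕ}
    (hJ : ∀ j ∈ J, c.gateDepth ⟨j, j.isLt.trans i.isLt⟩ ≤ D) : c.gateDepth i ≤ D + 1 := by
  rw [gateDepth, h]
  exact Nat.succ_le_succ (Finset.sup_le hJ)

/-- The conjunction over `a` of the disjunctions over `b ∈ t a` of the conjunctions of the input
variables in `r b`. The gates are numbered as follows: `n` input gates, `B` conjunctions, `A`
disjunctions, and the output gate. -/
def andOrAnd {n A B : ℕ} (t : Fin A → Finset (Fin B)) (r : Fin B → Finset (Fin n)) :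
    BoolCircuit n where
  size := n + B + A + 1
  gate i :=
    if h₁ : (i : ℕ) < n then .input ⟨i, h₁⟩
    else if h₂ : (i : ℕ) < n + B then
      .and (Finset.univ.filter fun j => ∃ c ∈ r ⟨i - n, by omega⟩, (j : ℕ) = c)
    else if h₃ : (i : ℕ) < n + B + A then
      .or (Finset.univ.filter fun j => ∃ b ∈ t ⟨i - (n + B), by omega⟩, (j : ℕ) = n + b)
    else .and (Finset.univ.filter fun j => n + B ≤ (j : ℕ))
  output := Fin.last _

theorem andOrAnd_gate_input {n A B : ℕ} (t : Fin A → Finset (Fin B))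
    (r : Fin B → Finset (Fin n)) (c : Fin n) (h : (c : ℕ) < (andOrAnd t r).size) :
    (andOrAnd t r).gate ⟨c, h⟩ = .input c := by
  simp [andOrAnd]

theorem andOrAnd_gate_and {n A B : ℕ} (t : Fin A → Finset (Fin B))
    (r : Fin B → Finset (Fin n)) (b : Fin B) (h : n + (b : ℕ) < (andOrAnd t r).size) :
    (andOrAnd t r).gate ⟨n + b, h⟩ =
      .and (Finset.univ.filter fun j => ∃ c ∈ r b, (j : ℕ) = c) := by
  simp [andOrAnd]

theorem andOrAnd_gate_or {n A B : ℕ} (t : Fin A → Finset (Fin B))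
    (r : Fin B → Finset (Fin n)) (a : Fin A) (h : n + B + (a : ℕ) < (andOrAnd t r).size) :
    (andOrAnd t r).gate ⟨n + B + a, h⟩ =
      .or (Finset.univ.filter fun j => ∃ b ∈ t a, (j : ℕ) = n + b) := by
  have h₁ : ¬ n + B + (a : ℕ) < n := by omega
  simp [andOrAnd, h₁]

theorem andOrAnd_gate_output {n A B : ℕ} (t : Fin A → Finset (Fin B))
    (r : Fin B → Finset (Fin n)) :
    (andOrAnd t r).gate (andOrAnd t r).output =
      .and (Finset.univ.filter fun j => n + B ≤ (j : ℕ)) := by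
  have h₁ : ¬ n + B + A < n := by omega
  have h₂ : ¬ n + B + A < n + B := by omega
  simp [andOrAnd, h₁, h₂]
  rfl

theorem andOrAnd_eval {n A B : ℕ} (t : Fin A → Finset (Fin B)) (r : Fin B → Finset (Fin n))
    (x : Fin n → Bool) :
    (andOrAnd t r).eval x = true ↔ ∀ a, ∃ b ∈ t a, ∀ c ∈ r b, x c = true := by
  have hand : ∀ (b : Fin B) (h : n + (b : ℕ) < (andOrAnd t r).size),
      (andOrAnd t r).gateValue x ⟨n + b, h⟩ = true ↔ ∀ c ∈ r b, x c = true := by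
    intro b h
    rw [gateValue_of_and (andOrAnd_gate_and t r b h)]
    constructor
    · intro H c hc
      have := H ⟨c, by simp only; omega⟩ (by simpa using ⟨c, hc, rfl⟩)
      exact (gateValue_of_input (andOrAnd_gate_input t r c _)).symm.trans this
    · rintro H ⟨j, hj⟩ hmem
      obtain ⟨c, hc, rfl⟩ := (Finset.mem_filter.1 hmem).2
      exact (gateValue_of_input (andOrAnd_gate_input t r c _)).trans (H c hc)
  have hor : ∀ (a : Fin A) (h : n + B + (a : ℕ) < (andOrAnd t r).size),
      (andOrAnd t r).gateValue x ⟨n + B + a, h⟩ = true ↔ ∃ b ∈ t a, ∀ c ∈ r b, x c = true := by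
    intro a h
    rw [gateValue_of_or (andOrAnd_gate_or t r a h)]
    constructor
    · rintro ⟨⟨j, hj⟩, hmem, hval⟩
      obtain ⟨b, hb, rfl⟩ := (Finset.mem_filter.1 hmem).2
      exact ⟨b, hb, (hand b _).1 hval⟩
    · rintro ⟨b, hb, hval⟩
      exact ⟨⟨n + b, by simp only; omega⟩, by simpa using ⟨b, hb, rfl⟩, (hand b _).2 hval⟩
  rw [eval, gateValue_of_and (andOrAnd_gate_output t r)]
  constructor
  · intro H a
    exact (hor a _).1 (H ⟨n + B + a, by simp [andOrAnd]⟩ (by simp [Nat.add_assoc]))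
  · rintro H ⟨j, hj⟩ hmem
    have hle : n + B ≤ j := (Finset.mem_filter.1 hmem).2
    obtain ⟨a, rfl⟩ := Nat.exists_eq_add_of_le hle
    have ha : a < A := by simpa [andOrAnd] using hj
    exact (hor ⟨a, ha⟩ _).2 (H ⟨a, ha⟩)

theorem andOrAnd_depth_le {n A B : ℕ} (t : Fin A → Finset (Fin B))
    (r : Fin B → Finset (Fin n)) : (andOrAnd t r).depth ≤ 3 := by
  refine gateDepth_of_and_le (andOrAnd_gate_output t r) ?_
  rintro ⟨j, hj⟩ hmem
  have hle : n + B ≤ j := (Finset.mem_filter.1 hmem).2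
  obtain ⟨a, rfl⟩ := Nat.exists_eq_add_of_le hle
  have ha : a < A := by simpa [andOrAnd] using hj
  refine gateDepth_of_or_le (andOrAnd_gate_or t r ⟨a, ha⟩ _) ?_
  rintro ⟨j, hj⟩ hmem
  obtain ⟨b, -, rfl⟩ := (Finset.mem_filter.1 hmem).2
  refine gateDepth_of_and_le (andOrAnd_gate_and t r b _) ?_
  rintro ⟨j, hj⟩ hmem
  obtain ⟨c, -, rfl⟩ := (Finset.mem_filter.1 hmem).2
  exact (gateDepth_of_input (andOrAnd_gate_input t r c _)).le

end BoolCircuit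

/-! ### Random depth-three formulas -/

/-- The probability that a uniformly random element of a finite type satisfies `p`. -/
noncomputable def uniformProb (Ω : Type*) [Fintype Ω] (p : Ω → Prop) : ℝ :=
  (Nat.card {ω // p ω} : ℝ) / Nat.card Ω

theorem uniformProb_not {Ω : Type*} [Fintype Ω] [Nonempty Ω] (p : Ω → Prop) :
    uniformProb Ω (fun ω => ¬ p ω) = 1 - uniformProb Ω p := by
  classical
  have hΩ : (Nat.card Ω : ℝ) ≠ 0 := by simp
  have h : (Nat.card {ω // p ω} : ℝ) + Nat.card {ω // ¬ p ω} = Nat.card Ω := by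
    simp only [Nat.card_eq_fintype_card]
    rw [← Fintype.card_congr (Equiv.sumCompl p), Fintype.card_sum, Nat.cast_add]
  unfold uniformProb
  rw [eq_sub_iff_add_eq, ← add_div, add_comm, h, div_self hΩ]

theorem uniformProb_forall {Ω : Type*} [Fintype Ω] (p : Ω → Prop) (k : ℕ) :
    uniformProb (Fin k → Ω) (fun ω => ∀ i, p (ω i)) = uniformProb Ω p ^ k := by
  unfold uniformProb
  rw [Nat.card_congr (Equiv.subtypePiEquivPi (p := fun _ => p)), Nat.card_pi, Nat.card_pi]
  simp [div_pow]

theorem uniformProb_exists {Ω : Type*} [Fintype Ω] [Nonempty Ω] (p : Ω → Prop) (k : ℕ) :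
    uniformProb (Fin k → Ω) (fun ω => ∃ i, p (ω i)) = 1 - (1 - uniformProb Ω p) ^ k := by
  rw [← uniformProb_not, ← uniformProb_forall, ← uniformProb_not]
  simp only [not_forall, not_not]

/-- The union bound: if the probabilities of finitely many bad events sum to less than `1`, then
some outcome avoids all of them. -/
theorem exists_forall_not_of_uniformProb {Ω ι : Type*} [Fintype Ω] [Nonempty Ω] [Fintype ι]
    (bad : ι → Ω → Prop) (ε : ℝ) (hbad : ∀ x, uniformProb Ω (bad x) ≤ ε)
    (hε : Fintype.card ι * ε < 1) : ∃ ω, ∀ x, ¬ bad x ω := by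
  classical
  by_contra! hall
  have hΩ : (0 : ℝ) < Nat.card Ω := by exact_mod_cast Nat.card_pos
  have hcover : Fintype.card Ω ≤ ∑ x, Nat.card {ω // bad x ω} := by
    calc Fintype.card Ω ≤ (Finset.univ.biUnion fun x => Finset.univ.filter (bad x)).card := by
          rw [← Finset.card_univ]
          refine Finset.card_le_card fun ω _ => ?_
          simpa using hall ω
      _ ≤ ∑ x, (Finset.univ.filter (bad x)).card := Finset.card_biUnion_le
      _ = _ := Finset.sum_congr rfl fun x _ => by
          rw [Nat.card_eq_fintype_card, Fintype.card_subtype]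
  have hsum : ∑ x, uniformProb Ω (bad x) ≤ Fintype.card ι * ε := by
    refine (Finset.sum_le_card_nsmul _ _ ε fun x _ => hbad x).trans ?_
    simp
  unfold uniformProb at hsum
  rw [← Finset.sum_div] at hsum
  have : (1 : ℝ) ≤ (∑ x, (Nat.card {ω // bad x ω} : ℝ)) / Nat.card Ω := by
    rw [one_le_div hΩ, Nat.card_eq_fintype_card]
    exact_mod_cast hcover
  linarith

theorem uniformProb_fin_eq {n : ℕ} (x : Fin n → Bool) :
    uniformProb (Fin n) (fun i => x i = true) = numOnes x / n := by
  unfold uniformProb numOnes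
  rw [Nat.card_eq_fintype_card, Fintype.card_subtype, Nat.card_eq_fintype_card, Fintype.card_fin]

/-- The value on `x` of the formula given by `ω`: a conjunction of `n` disjunctions of `M`
conjunctions of `k` input variables. -/
def formulaTrue {n A M k : ℕ} (ω : Fin A → Fin M → Fin k → Fin n) (x : Fin n → Bool) : Prop :=
  ∀ a, ∃ b, ∀ c, x (ω a b c) = true

theorem uniformProb_formulaTrue {n A M k : ℕ} [NeZero n] (x : Fin n → Bool) :
    uniformProb (Fin A → Fin M → Fin k → Fin n) (fun ω => formulaTrue ω x) =
      (1 - (1 - (numOnes x / n : ℝ) ^ k) ^ M) ^ A := by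
  unfold formulaTrue
  rw [uniformProb_forall (fun ω : Fin M → Fin k → Fin n => ∃ b, ∀ c, x (ω b c) = true),
    uniformProb_exists (fun ω : Fin k → Fin n => ∀ c, x (ω c) = true),
    uniformProb_forall (fun i : Fin n => x i = true), uniformProb_fin_eq]

theorem exists_andOrAnd_circuit {n A M k : ℕ} (ω : Fin A → Fin M → Fin k → Fin n) :
    ∃ c : BoolCircuit n, c.depth ≤ 3 ∧ c.size = n + A * M + A + 1 ∧
      ∀ x, c.eval x = true ↔ formulaTrue ω x := by
  classical
  obtain ⟨f⟩ : Nonempty (Fin A × Fin M ≃ Fin (A * M)) := ⟨finProdFinEquiv⟩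
  refine ⟨BoolCircuit.andOrAnd
    (fun a => Finset.univ.image fun b : Fin M => f (a, b))
    (fun q => Finset.univ.image (ω (f.symm q).1 (f.symm q).2)),
    BoolCircuit.andOrAnd_depth_le _ _, rfl, fun x => ?_⟩
  rw [BoolCircuit.andOrAnd_eval]
  simp [formulaTrue]

/-- If at least two thirds of the bits are ones, then a disjunction of `2 ^ k * l` random
conjunctions of `k` variables is false with probability at most `2⁻ˡ`. -/
theorem pow_le_of_two_thirds_le {p : ℝ} (hp : 2 / 3 ≤ p) (hp1 : p ≤ 1) (k l : ℕ) :
    (1 - p ^ k) ^ (2 ^ k * l) ≤ (1 / 2) ^ l := by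
  have hp0 : 0 ≤ p := by linarith
  have hpk : p ^ k ≤ 1 := pow_le_one₀ hp0 hp1
  rw [pow_mul]
  refine pow_le_pow_left₀ (by positivity [sub_nonneg.2 hpk]) ?_ l
  have h1 : (1 - p ^ k) ^ 2 ^ k * (1 + p ^ k) ^ 2 ^ k ≤ 1 := by
    rw [← mul_pow]
    exact pow_le_one₀ (mul_nonneg (sub_nonneg.2 hpk) (by positivity))
      (by nlinarith [pow_nonneg hp0 k])
  have h2 : 2 ≤ (1 + p ^ k) ^ 2 ^ k := by
    have hb := one_add_mul_le_pow (a := p ^ k) (by linarith [pow_nonneg hp0 k]) (2 ^ k)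
    have h3 : (1 : ℝ) ≤ (2 ^ k : ℕ) * p ^ k := by
      push_cast
      rw [← mul_pow]
      exact one_le_pow₀ (by linarith)
    linarith
  have h4 : 0 ≤ (1 - p ^ k) ^ 2 ^ k := pow_nonneg (sub_nonneg.2 hpk) _
  nlinarith

theorem one_sub_pow_le_mul {q : ℝ} (hq1 : q ≤ 1) (M : ℕ) :
    1 - (1 - q) ^ M ≤ M * q := by
  have := one_add_mul_le_pow (a := -q) (by linarith) M
  rw [← sub_eq_add_neg] at this
  linarith

/-- Random formulas with suitable parameters have positive probability of approximating the
majority of `n` bits on all inputs at once. -/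
theorem exists_formula_approximating_majority {n k : ℕ} (hn : 1 ≤ n)
    (hk : (24 * n : ℝ) ≤ (3 / 2) ^ k) :
    ∃ ω : Fin n → Fin (2 ^ k * (3 * n)) → Fin k → Fin n, ∀ x : Fin n → Bool,
      ((2 * n / 3 : ℝ) ≤ numOnes x → formulaTrue ω x) ∧
      ((numOnes x : ℝ) ≤ n / 3 → ¬ formulaTrue ω x) := by
  have : NeZero n := ⟨by omega⟩
  have hn0 : (0 : ℝ) < n := by exact_mod_cast hn
  have hnum : ∀ x : Fin n → Bool, (numOnes x : ℝ) ≤ n := fun x => by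
    exact_mod_cast (Finset.card_filter_le _ _).trans (by simp)
  let bad : (Fin n → Bool) → (Fin n → Fin (2 ^ k * (3 * n)) → Fin k → Fin n) → Prop := fun x ω =>
    if (2 * n / 3 : ℝ) ≤ numOnes x then ¬ formulaTrue ω x
    else (numOnes x : ℝ) ≤ n / 3 ∧ formulaTrue ω x
  have hbad : ∀ x, uniformProb _ (bad x) ≤ n * (1 / 8 : ℝ) ^ n := by
    intro x
    set p : ℝ := numOnes x / n with hp
    have hp0 : 0 ≤ p := by positivity
    have hp1 : p ≤ 1 := (div_le_one hn0).2 (hnum x)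
    by_cases hx : (2 * n / 3 : ℝ) ≤ numOnes x
    · have hp23 : 2 / 3 ≤ p := by
        rw [hp, le_div_iff₀ hn0]
        linarith
      have herr := pow_le_of_two_thirds_le hp23 hp1 k (3 * n)
      have h8 : (1 / 2 : ℝ) ^ (3 * n) = (1 / 8) ^ n := by
        rw [pow_mul]
        norm_num
      rw [h8] at herr
      simp only [bad, if_pos hx]
      rw [uniformProb_not, uniformProb_formulaTrue, ← hp]
      have hq0 : 0 ≤ (1 - p ^ k) ^ (2 ^ k * (3 * n)) :=
        pow_nonneg (sub_nonneg.2 (pow_le_one₀ hp0 hp1)) _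
      have hq1 : (1 - p ^ k) ^ (2 ^ k * (3 * n)) ≤ 1 :=
        pow_le_one₀ (sub_nonneg.2 (pow_le_one₀ hp0 hp1)) (by linarith [pow_nonneg hp0 k])
      exact (one_sub_pow_le_mul hq1 n).trans (mul_le_mul_of_nonneg_left herr hn0.le)
    · simp only [bad, if_neg hx]
      by_cases hx' : (numOnes x : ℝ) ≤ n / 3
      · have hp13 : p ≤ 1 / 3 := by
          rw [hp, div_le_iff₀ hn0]
          linarith
        have hpk : p ^ k ≤ (1 / 3) ^ k := pow_le_pow_left₀ hp0 hp13 k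
        simp only [hx', true_and]
        rw [uniformProb_formulaTrue, ← hp]
        have herr : 1 - (1 - p ^ k) ^ (2 ^ k * (3 * n)) ≤ 1 / 8 := by
          refine (one_sub_pow_le_mul (pow_le_one₀ hp0 hp1) _).trans ?_
          push_cast
          -- the factor `3 n` is absorbed by `(2/3) ^ k`
          have h1 : (2 : ℝ) ^ k * (3 * n) * p ^ k ≤ 2 ^ k * (3 * n) * (1 / 3) ^ k :=
            mul_le_mul_of_nonneg_left hpk (by positivity)
          have h2 : (2 : ℝ) ^ k * (3 * n) * (1 / 3) ^ k = 3 * n * (2 / 3) ^ k := by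
            rw [mul_right_comm, ← mul_pow]
            ring
          have h3 : (3 / 2 : ℝ) ^ k * (2 / 3) ^ k = 1 := by
            rw [← mul_pow]
            norm_num
          have h4 : (24 * n : ℝ) * (2 / 3) ^ k ≤ 1 :=
            h3 ▸ mul_le_mul_of_nonneg_right hk (by positivity)
          linarith
        have hq0 : 0 ≤ 1 - (1 - p ^ k) ^ (2 ^ k * (3 * n)) :=
          sub_nonneg.2 (pow_le_one₀ (sub_nonneg.2 (pow_le_one₀ hp0 hp1))
            (by linarith [pow_nonneg hp0 k]))
        refine (pow_le_pow_left₀ hq0 herr n).trans ?_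
        exact le_mul_of_one_le_left (by positivity) (by exact_mod_cast hn)
      · simp only [hx', false_and]
        have : uniformProb (Fin n → Fin (2 ^ k * (3 * n)) → Fin k → Fin n)
            (fun _ => False) = 0 := by
          simp [uniformProb]
        rw [this]
        positivity
  have hε : Fintype.card (Fin n → Bool) * (n * (1 / 8 : ℝ) ^ n) < 1 := by
    have h1 : (2 : ℝ) ^ n * (n * (1 / 8) ^ n) = n * (1 / 4) ^ n := by
      rw [mul_left_comm, ← mul_pow]
      norm_num
    have h2 : (n : ℝ) < 4 ^ n := by exact_mod_cast Nat.lt_pow_self (by norm_num)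
    simp only [Fintype.card_pi, Fintype.card_bool, Finset.prod_const, Finset.card_univ,
      Fintype.card_fin]
    push_cast
    rw [h1, one_div, inv_pow, ← div_eq_mul_inv, div_lt_one (by positivity)]
    exact h2
  obtain ⟨ω, hω⟩ := exists_forall_not_of_uniformProb bad _ hbad hε
  refine ⟨ω, fun x => ⟨fun hx => ?_, fun hx hval => ?_⟩⟩
  · have := hω x
    simp only [bad, if_pos hx, not_not] at this
    exact this
  · have hlt : ¬ (2 * n / 3 : ℝ) ≤ numOnes x := by linarith
    have := hω x
    simp only [bad, if_neg hlt, not_and] at this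
    exact this hx hval

/-- For each length, the circuit is the depth-three formula that exists by the union bound. -/
theorem exists_isAC0_approximatesMajority :
    ∃ C : CircuitFamily, C.IsAC0 ∧ C.ApproximatesMajority := by
  have hcirc : ∀ n : ℕ, ∃ c : BoolCircuit n, c.depth ≤ 3 ∧
      c.size ≤ n + n * ((48 * n) ^ 2 * (3 * n)) + n + 1 ∧
      (1 ≤ n → ∀ x : Fin n → Bool,
        ((2 * n / 3 : ℝ) ≤ numOnes x → c.eval x = true) ∧
        ((numOnes x : ℝ) ≤ (n / 3 : ℝ) → c.eval x = false)) := by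
    intro n
    rcases Nat.eq_zero_or_pos n with rfl | hn
    · obtain ⟨c, hd, hs, -⟩ := exists_andOrAnd_circuit (n := 0) (A := 0) (M := 0) (k := 0) nofun
      exact ⟨c, hd, by omega, by omega⟩
    -- For `k = 2 l` with `2 ^ l` about `24 n`, the power `(3/2) ^ k = (9/4) ^ l` is at least `24 n`,
    -- and `2 ^ k` is at most quadratic in `n`.
    set l := Nat.clog 2 (24 * n) with hl
    have hl1 : 24 * n ≤ 2 ^ l := Nat.le_pow_clog (by norm_num) _
    have hl2 : 2 ^ l ≤ 48 * n := by
      have := Nat.pow_pred_clog_lt_self (b := 2) (by norm_num) (x := 24 * n) (by omega)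
      have hpos : 0 < l := Nat.clog_pos (by norm_num) (by omega)
      have hsucc : 2 ^ l = 2 * 2 ^ (l - 1) := by
        rw [← pow_succ', Nat.sub_add_cancel hpos]
      rw [Nat.pred_eq_sub_one, ← hl] at this
      omega
    have hk : (24 * n : ℝ) ≤ (3 / 2) ^ (2 * l) := by
      calc (24 * n : ℝ) ≤ 2 ^ l := by exact_mod_cast hl1
        _ ≤ ((3 / 2) ^ 2) ^ l := pow_le_pow_left₀ (by norm_num) (by norm_num) l
        _ = _ := (pow_mul _ _ _).symm
    obtain ⟨ω, hω⟩ := exists_formula_approximating_majority hn hk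
    obtain ⟨c, hd, hs, hc⟩ := exists_andOrAnd_circuit ω
    refine ⟨c, hd, ?_, fun _ x => ⟨fun hx => (hc x).2 ((hω x).1 hx), fun hx => ?_⟩⟩
    · have h2k : 2 ^ (2 * l) ≤ (48 * n) ^ 2 := by
        rw [mul_comm, pow_mul]
        exact Nat.pow_le_pow_left hl2 2
      rw [hs]
      gcongr
    · rw [← Bool.not_eq_true, hc]
      exact (hω x).2 hx
  choose C hd hs hC using hcirc
  refine ⟨C, ⟨⟨3, hd⟩, ⟨.X + .X * ((48 * .X) ^ 2 * (3 * .X)) + .X + 1, fun n => ?_⟩⟩, hC⟩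
  simpa using hs n

theorem mainTheorem4 :
    (∃ C : CircuitFamily, C.IsAC0 ∧ C.ApproximatesMajority) ∧
    (∀ C : CircuitFamily, C.IsAC0 → C.ApproximatesMajority →
      ¬ ∃ (d e : ℕ) (T : UHAT d e), T.Accepts C.language) ∧
    (∃ L : Language Bool, InAC0 L ∧ ¬ ∃ (d e : ℕ) (T : UHAT d e), T.Accepts L) := by
  have hnot : ∀ C : CircuitFamily, C.ApproximatesMajority →
      ¬ ∃ (d e : ℕ) (T : UHAT d e), T.Accepts C.language := by
    rintro C hC ⟨d, e, T, hT⟩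
    exact hC.not_accepts T hT
  obtain ⟨C, hAC, hC⟩ := exists_isAC0_approximatesMajority
  exact ⟨⟨C, hAC, hC⟩, fun C _ => hnot C, ⟨C.language, ⟨C, hAC, rfl⟩, hnot C hC⟩⟩
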